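/- \textbf{Setting.} An Orlicz N-function is a continuous even convex $\varphi:\mathbb R\to\mathbb R$, increasing on $(0,\infty)$, with $\varphi(0)=0$, $\varphi(x)/x\to0$ as $x\to0$ and $\varphi(x)/x\to\infty$ as $x\to\infty$. Let $\varphi$ be such a function with $\lim_{x\to0}\varphi(x)/x^2\in(0,\infty]$. Put $\varphi^*(x)=\sup_{y\in\mathbb R}(xy-\varphi(y))$, and let $f$ be a density of $\varphi$, i.e. a nondecreasing right-continuous function on $[0,\infty)$ with $f(0)=0$, $f(x)\to\infty$ as $x\to\infty$, and $\varphi(u)=\int_0^{|u|}f(v)\,dv$. On a probability space, a real random variable $\xi$ is in $Sub_\varphi(\Omega)$ if $\mathbf E\xi=0$ and, for some $a\ge0$, $\mathbf E e^{\lambda\xi}\le e^{\varphi(a\lambda)}$ for all $\lambda\in\mathbb R$; $\tau_\varphi(\xi)$ is the infimum of such $a$. Let $\mathbf X(t)$, $t\in\mathbb R$, be a jointly measurable real process which is strictly $Sub_\varphi(\Omega)$ with determinative constant $C_X>0$: every $\mathbf X(t)$ is in $Sub_\varphi(\Omega)$, and $\tau_\varphi(\eta)\le C_X(\mathbf E\eta^2)^{1/2}$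 for every finite linear combination $\eta$ of the variables $\mathbf X(t)$. Let $T>0$ and $p\ge1$. \textbf{(1)} If $\int_0^T(\mathbf E\mathbf X(t)^2)^{p/2}dt<\infty$, then $\int_0^T\tau_\varphi(\mathbf X(t))^p\,dt<\infty$. \textbf{Wavelets.} Write $\widehat g(y)=\int_{\mathbb R}e^{-iyx}g(x)\,dx$. Let $\phi,\psi:\mathbb R\to\mathbb R$ be continuous. Assume that $\phi$ is an f-wavelet, i.e. $\phi\in L_2(\mathbb R)$, $\widehat\phi(0)\ne0$, $\widehat\phi$ is continuous at $0$, $\sum_{k\in\mathbb Z}|\widehat\phi(y+2\pi k)|^2=1$ a.e., and there is a $2\pi$-periodic $m_0\in L_2([0,2\pi])$ with $\widehat\phi(y)=m_0(y/2)\widehat\phi(y/2)$ a.e. Assume that $\psi$ is the corresponding m-wavelet, i.e. $\widehat\psi(y)=\overline{m_0(y/2+\pi)}\,e^{-iy/2}\,\widehat\phi(y/2)$ a.e. Assume further that there are functions $\Phi,c,A$ such that: $\Phi$ is nonincreasing on $[0,\infty)$, $|\phi(x)|\le\Phi(|x|)$ and $|\psi(x)|\le\Phi(|x|)$ a.e.,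 and $\int_{\mathbb R}\Phi(|x|)\,dx<\infty$; $c:\mathbb R\to\mathbb R$ is even and nondecreasing on $[0,\infty)$, with $c(0)>1$ and $\int_{\mathbb R}c(x)\Phi(|x|)\,dx<\infty$; $A:(0,\infty)\to(0,\infty)$ and, for some $x_0\in\mathbb R$, $c(ax)\le c(x)A(a)$ for all $a>0$ and $x\ge x_0$. Finally, assume that $\mathbf X$ is continuous in the norm $\tau_\varphi$ and that $\tau_\varphi(\mathbf X(t))\le c(t)$ for all $t\in\mathbb R$. Let $\phi_{jk}(t)=2^{j/2}\phi(2^jt-k)$ and $\psi_{jk}(t)=2^{j/2}\psi(2^jt-k)$. With the mean-square integrals $\xi_{0k}=\int_{\mathbb R}\mathbf X(t)\phi_{0k}(t)\,dt$ and $\eta_{jk}=\int_{\mathbb R}\mathbf X(t)\psi_{jk}(t)\,dt$, and with $\mathbf k_n=(k_0',k_0,\dots,k_{n-1})$ a tuple of nonnegative integers, put $$\mathbf X_{n,\mathbf k_n}(t)=\sum_{|k|\le k_0'}\xi_{0k}\phi_{0k}(t)+\sum_{j=0}^{n-1}\sum_{|k|\le k_j}\eta_{jk}\psi_{jk}(t).$$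 \textbf{(2)} Let $(\mathbf k_n)_n$ be any sequence of such tuples with $k_0'(n)\to\infty$ and, for every $j$, $k_j(n)\to\infty$ as $n\to\infty$. If $\int_0^T\big(\mathbf E(\mathbf X_{n,\mathbf k_n}(t)-\mathbf X_{m,\mathbf k_m}(t))^2\big)^{p/2}dt\to0$ as $n,m\to\infty$, then $\int_0^T\tau_\varphi\big(\mathbf X_{n,\mathbf k_n}(t)-\mathbf X_{m,\mathbf k_m}(t)\big)^p\,dt\to0$ as $n,m\to\infty$. \textbf{(3)} For every $n\geq 0$ and every $\mathbf k_n$, the number $$c_n^\infty=C_X^p\int_0^T\big(\mathbf E(\mathbf X_{n,\mathbf k_n}(t)-\mathbf X(t))^2\big)^{p/2}dt$$ is finite, and for every $\varepsilon>0$ with $\varepsilon>c_n^\infty\big(f(p(c_n^\infty/\varepsilon)^{1/p})\big)^p$, $$\mathbf P\Big\{\int_0^T|\mathbf X_{n,\mathbf k_n}(t)-\mathbf X(t)|^p\,dt>\varepsilon\Big\}\le2\exp\Big\{-\varphi^*\big((\varepsilon/c_n^\infty)^{1/p}\big)\Big\},$$ where the right-hand side is read as $0$ if $c_n^\infty=0$.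 -/

import Mathlib

open MeasureTheory Filter Topology
open scoped ENNReal NNReal

noncomputable section

namespace PhiSub

/-- Orlicz N-functions. -/
structure IsOrliczN (φ : ℝ → ℝ) : Prop where
  cont : Continuous φ
  even : ∀ x, φ (-x) = φ x
  convex : ConvexOn ℝ Set.univ φ
  increasing : StrictMonoOn φ (Set.Ioi 0)
  map_zero : φ 0 = 0
  lim_zero : Tendsto (fun x => φ x / x) (𝓝[≠] 0) (𝓝 0)
  lim_top : Tendsto (fun x => φ x / x) atTop atTop

/-- The limit of `φ x / x ^ 2` at `0` exists and is positive; the value `+∞` is allowed. -/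
def AssumptionQ (φ : ℝ → ℝ) : Prop :=
  ∃ c : EReal, 0 < c ∧ Tendsto (fun x : ℝ => ((φ x / x ^ 2 : ℝ) : EReal)) (𝓝[≠] 0) (𝓝 c)

/-- `f`, considered on `[0, ∞)`, is a density of the N-function `φ`. -/
structure IsDensity (φ f : ℝ → ℝ) : Prop where
  mono : MonotoneOn f (Set.Ici 0)
  right_cont : ∀ x, 0 ≤ x → ContinuousWithinAt f (Set.Ici x) x
  map_zero : f 0 = 0
  lim_top : Tendsto f atTop atTop
  eq_integral : ∀ u, φ u = ∫ v in (0 : ℝ)..|u|, f v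

/-- The Young-Fenchel transform (the supremum is finite for every N-function). -/
def youngFenchel (φ : ℝ → ℝ) (x : ℝ) : ℝ := ⨆ y : ℝ, (x * y - φ y)

section RandomVariables

variable {Ω : Type*} [MeasurableSpace Ω]

/-- `E exp (lam * ξ) ≤ exp (φ (a * lam))` for all real `lam`. The expectation is a Lebesgue
integral with values in `[0, ∞]`. -/
def ExpBound (φ : ℝ → ℝ) (P : Measure Ω) (ξ : Ω → ℝ) (a : ℝ) : Prop :=
  ∀ lam : ℝ, ∫⁻ ω, ENNReal.ofReal (Real.exp (lam * ξ ω)) ∂P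
    ≤ ENNReal.ofReal (Real.exp (φ (a * lam)))

/-- `ξ` belongs to the space of `φ`-sub-Gaussian random variables. -/
structure IsSub (φ : ℝ → ℝ) (P : Measure Ω) (ξ : Ω → ℝ) : Prop where
  meas : Measurable ξ
  mean_zero : Integrable ξ P ∧ ∫ ω, ξ ω ∂P = 0
  bound : ∃ r : ℝ, 0 ≤ r ∧ ExpBound φ P ξ r

/-- The norm `τ_φ`, with value `∞` when no constant is admissible. -/
def tau (φ : ℝ → ℝ) (P : Measure Ω) (ξ : Ω → ℝ) : ℝ≥0∞ :=
  sInf {b : ℝ≥0∞ | ∃ a : ℝ, 0 ≤ a ∧ ExpBound φ P ξ a ∧ b = ENNReal.ofReal a}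

/-- `E ξ ^ 2`, with values in `[0, ∞]`. -/
def secondMoment (P : Measure Ω) (ξ : Ω → ℝ) : ℝ≥0∞ :=
  ∫⁻ ω, ENNReal.ofReal (ξ ω ^ 2) ∂P

/-- `Ξ` is a strictly `φ`-sub-Gaussian family of random variables with determinative
constant `C`. -/
def IsStrictlySubFamily (φ : ℝ → ℝ) (P : Measure Ω) (Ξ : Set (Ω → ℝ)) (C : ℝ) : Prop :=
  0 < C ∧ (∀ ξ ∈ Ξ, IsSub φ P ξ) ∧
    ∀ (m : ℕ) (ξ : Fin m → Ω → ℝ), (∀ i, ξ i ∈ Ξ) → ∀ lam : Fin m → ℝ,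
      tau φ P (fun ω => ∑ i, lam i * ξ i ω)
        ≤ ENNReal.ofReal C * secondMoment P (fun ω => ∑ i, lam i * ξ i ω) ^ (1 / 2 : ℝ)

/-- Continuity of a process in the norm `τ_φ`. -/
def IsTauContinuous (φ : ℝ → ℝ) (P : Measure Ω) (X : ℝ → Ω → ℝ) : Prop :=
  ∀ t : ℝ, Tendsto (fun s => tau φ P (fun ω => X s ω - X t ω)) (𝓝 t) (𝓝 0)

end RandomVariables

section Wavelets

/-- The Fourier transform `y ↦ ∫ e^{-iyx} g(x) dx` of a real function. -/
def fourierT (g : ℝ → ℝ) (y : ℝ) : ℂ :=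
  ∫ x : ℝ, Complex.exp (-(Complex.I * (y : ℂ) * (x : ℂ))) * (g x : ℂ)

/-- `m₀` is square integrable on `[0, 2π]`, `2π`-periodic, and satisfies the two-scale relation
with `φ`. -/
structure IsScalingFilter (φ : ℝ → ℝ) (m₀ : ℝ → ℂ) : Prop where
  memLp : MemLp m₀ 2 (volume.restrict (Set.Icc 0 (2 * Real.pi)))
  periodic : Function.Periodic m₀ (2 * Real.pi)
  two_scale : ∀ᵐ y : ℝ, fourierT φ y = m₀ (y / 2) * fourierT φ (y / 2)

/-- `φ` is an f-wavelet. -/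
structure IsFWavelet (φ : ℝ → ℝ) : Prop where
  memLp : MemLp φ 2 volume
  fourier_zero : fourierT φ 0 ≠ 0
  fourier_cont : ContinuousAt (fourierT φ) 0
  partition : ∀ᵐ y : ℝ, HasSum (fun k : ℤ => ‖fourierT φ (y + 2 * Real.pi * (k : ℝ))‖ ^ 2) 1
  filter : ∃ m₀ : ℝ → ℂ, IsScalingFilter φ m₀

/-- `ψ` is the m-wavelet of the f-wavelet `φ`: an integrable and square integrable function whose
Fourier transform is `conj (m₀ (y/2 + π)) e^{-iy/2} φ̂(y/2)`, that is, `ψ` is the inverse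
Fourier transform of this function. -/
def IsMWavelet (φ ψ : ℝ → ℝ) : Prop :=
  Integrable ψ ∧ MemLp ψ 2 volume ∧ ∃ m₀ : ℝ → ℂ, IsScalingFilter φ m₀ ∧
    ∀ᵐ y : ℝ, fourierT ψ y =
      (starRingEnd ℂ) (m₀ (y / 2 + Real.pi)) * Complex.exp (-(Complex.I * ((y / 2 : ℝ) : ℂ)))
        * fourierT φ (y / 2)

/-- `Φ` is a decreasing integrable radial majorant of `δ`. -/
structure AssumptionS (δ Φ : ℝ → ℝ) : Prop where
  decreasing : AntitoneOn Φ (Set.Ici 0)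
  le : ∀ᵐ x : ℝ, |δ x| ≤ Φ |x|
  integrable : Integrable (fun x : ℝ => Φ |x|)

/-- The requirements on the weight `c` (with the auxiliary function `A`). -/
structure IsWeight (c A : ℝ → ℝ) : Prop where
  even : ∀ x, c (-x) = c x
  mono : MonotoneOn c (Set.Ici 0)
  one_lt : 1 < c 0
  A_pos : ∀ a, 0 < a → 0 < A a
  growth : ∃ x₀ : ℝ, ∀ a, 0 < a → ∀ x, x₀ ≤ x → c (a * x) ≤ c x * A a

/-- `δ_{jk}(x) = 2^{j/2} δ(2^j x - k)`. -/
def dil (δ : ℝ → ℝ) (j : ℕ) (k : ℤ) (x : ℝ) : ℝ :=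
  (2 : ℝ) ^ ((j : ℝ) / 2) * δ ((2 : ℝ) ^ j * x - (k : ℝ))

variable {Ω : Type*} [MeasurableSpace Ω]

open Classical in
/-- The class in `L₂(Ω)` of a square integrable random variable. -/
def toL2 (P : Measure Ω) (Y : Ω → ℝ) : Lp ℝ 2 P :=
  if h : MemLp Y 2 P then h.toLp Y else 0

/-- The mean-square integral `∫ X(t) g(t) dt`, an integral of a function with values in the
Hilbert space `L₂(Ω)`. -/
def msIntegral (P : Measure Ω) (X : ℝ → Ω → ℝ) (g : ℝ → ℝ) : Lp ℝ 2 P :=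
  ∫ t : ℝ, g t • toL2 P (X t)

/-- The approximant with `n` levels, `|k| ≤ k'` at the coarse level and `|k| ≤ kk j` at the
level `j < n`. -/
def approx (P : Measure Ω) (φ ψ : ℝ → ℝ) (X : ℝ → Ω → ℝ) (n k' : ℕ) (kk : ℕ → ℕ)
    (t : ℝ) (ω : Ω) : ℝ :=
  (∑ k ∈ Finset.Icc (-(k' : ℤ)) (k' : ℤ), msIntegral P X (dil φ 0 k) ω * dil φ 0 k t)
    + ∑ j ∈ Finset.range n, ∑ k ∈ Finset.Icc (-(kk j : ℤ)) (kk j : ℤ),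
        msIntegral P X (dil ψ j k) ω * dil ψ j k t

end Wavelets

end PhiSub

end

namespace PhiSub

/-! ### N-functions and their densities. -/

section OrliczFunctions

variable {φ : ℝ → ℝ}

/-! Everything happens in the closed linear span of the process in L₂(Ω). On finite combinations,
strictness says that `E exp (λη) ≤ exp (φ (C ‖η‖ λ))`. An L₂-convergent sequence has an a.e.
convergent subsequence, so Fatou's lemma and continuity of `φ` carry this bound to the closed span
(`expBound_of_mem_closedSpan`). Mean-square integrals are L₂-valued Bochner integrals, hence lie in
the closed span, and so do the approximants at each time and their differences. Thus `τ_φ ≤ C ‖·‖₂`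
for all of them, and integrating `p`-th powers gives (1) and (2).

For (3), let `G` be the error, `b t = C ‖G t‖₂`, `c = ∫ b ^ p` and `u = (ε / c) ^ (1 / p)`; `c` is
finite because the mean square norms are bounded on `[0, T]`. Take `x` with `s = u x ≥ p`. As a
function of `r ^ p`, `exp (s r)` lies above its tangent at `r = 1`. Applying this with `r = |G| / (b
u)` and averaging over `t` with the weight `b ^ p / c` gives `∫ (b ^ p / c) exp (x |G| / b) ≥ exp s`
whenever `∫ |G| ^ p > ε`. The expectation of the left side is at most `2 exp (φ x)`, so Markov's
inequality bounds the probability by `2 exp (-(u x - φ x))` for all `x ≥ p / u`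
(`measure_lt_lintegral_le`). The condition on `ε` says exactly that `f (p / u) < u`; then `u y - φ
y` does not exceed its value at `p / u` for `0 ≤ y ≤ p / u`, and the supremum over `x ≥ p / u` is
already `φ* u`. -/

lemma IsOrliczN.monotoneOn (hφ : IsOrliczN φ) : MonotoneOn φ (Set.Ici 0) := by
  intro x hx y _ hxy
  have hx' : (0 : ℝ) ≤ x := hx
  -- By evenness both endpoints of `[-y, y]` carry the same value, which dominates `φ` in between;
  -- this includes the point `0`, where strict monotonicity is not assumed.
  have h := hφ.convex.le_max_of_mem_Icc (Set.mem_univ (-y)) (Set.mem_univ y)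
    (show x ∈ Set.Icc (-y) y from ⟨by linarith, hxy⟩)
  rwa [hφ.even, max_self] at h

lemma IsOrliczN.map_abs (hφ : IsOrliczN φ) (x : ℝ) : φ |x| = φ x := by
  rcases abs_choice x with h | h <;> rw [h]
  exact hφ.even x

lemma IsOrliczN.le_of_abs_le (hφ : IsOrliczN φ) {x y : ℝ} (h : |x| ≤ |y|) : φ x ≤ φ y := by
  rw [← hφ.map_abs x, ← hφ.map_abs y]
  exact hφ.monotoneOn (abs_nonneg x) (abs_nonneg y) h

/-- If the density at `x₀` lies below `u`, then `y ↦ u * y - φ y` on `[0, x₀]` is maximal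
at `x₀`. -/
lemma IsDensity.sub_le_sub {f : ℝ → ℝ} (hf : IsDensity φ f) {u y x₀ : ℝ} (hy : 0 ≤ y)
    (hyx : y ≤ x₀) (hu : f x₀ ≤ u) : u * y - φ y ≤ u * x₀ - φ x₀ := by
  have hint : ∀ a b : ℝ, 0 ≤ a → 0 ≤ b → IntervalIntegrable f volume a b := fun a b ha hb =>
    (hf.mono.mono fun x hx => (le_min ha hb).trans hx.1).intervalIntegrable
  have h1 : φ x₀ - φ y = ∫ t in y..x₀, f t := by
    rw [hf.eq_integral x₀, hf.eq_integral y, abs_of_nonneg hy, abs_of_nonneg (hy.trans hyx)]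
    exact intervalIntegral.integral_interval_sub_left (hint _ _ le_rfl (hy.trans hyx))
      (hint _ _ le_rfl hy)
  have h2 : ∫ t in y..x₀, f t ≤ ∫ _ in y..x₀, u :=
    intervalIntegral.integral_mono_on hyx (hint _ _ hy (hy.trans hyx))
      intervalIntegrable_const fun t ht =>
        (hf.mono (hy.trans ht.1) (hy.trans hyx) ht.2).trans hu
  rw [intervalIntegral.integral_const, smul_eq_mul] at h2
  linarith

end OrliczFunctions

/-! ### Exponential moments, the norm `τ_φ` and second moments. -/

section ExponentialBounds

variable {Ω : Type*} [MeasurableSpace Ω] {P : Measure Ω} {φ : ℝ → ℝ}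

lemma ExpBound.mono (hφ : IsOrliczN φ) {ξ : Ω → ℝ} {a b : ℝ} (h : ExpBound φ P ξ a)
    (ha : 0 ≤ a) (hab : a ≤ b) : ExpBound φ P ξ b := fun lam =>
  (h lam).trans <| ENNReal.ofReal_le_ofReal <| Real.exp_le_exp.2 <| hφ.le_of_abs_le <| by
    rw [abs_mul, abs_mul, abs_of_nonneg ha, abs_of_nonneg (ha.trans hab)]
    gcongr

lemma ExpBound.congr {ξ η : Ω → ℝ} {a : ℝ} (h : ExpBound φ P ξ a) (hξη : η =ᵐ[P] ξ) :
    ExpBound φ P η a := fun lam =>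
  (lintegral_congr_ae (by filter_upwards [hξη] with ω hω; rw [hω])).trans_le (h lam)

/-- The infimum defining `τ_φ` is attained: every `b > a` is admissible, and continuity of `φ`
allows `b ↓ a`. -/
lemma expBound_of_tau_le (hφ : IsOrliczN φ) {ξ : Ω → ℝ} {a : ℝ} (ha : 0 ≤ a)
    (h : tau φ P ξ ≤ ENNReal.ofReal a) : ExpBound φ P ξ a := by
  intro lam
  have key : ∀ᶠ b in 𝓝[>] a, ∫⁻ ω, ENNReal.ofReal (Real.exp (lam * ξ ω)) ∂P
      ≤ ENNReal.ofReal (Real.exp (φ (b * lam))) := by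
    filter_upwards [self_mem_nhdsWithin] with b hb
    have hb' : a < b := hb
    have : tau φ P ξ < ENNReal.ofReal b :=
      h.trans_lt ((ENNReal.ofReal_lt_ofReal_iff (ha.trans_lt hb')).2 hb')
    obtain ⟨_, ⟨a', ha', hE, rfl⟩, hlt⟩ := sInf_lt_iff.1 this
    exact hE.mono hφ ha' ((ENNReal.ofReal_lt_ofReal_iff (ha.trans_lt hb')).1 hlt).le lam
  have hcont : Continuous fun b : ℝ => ENNReal.ofReal (Real.exp (φ (b * lam))) :=
    ENNReal.continuous_ofReal.comp (Real.continuous_exp.comp (hφ.cont.comp (by fun_prop)))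
  exact ge_of_tendsto (hcont.continuousAt.tendsto.mono_left nhdsWithin_le_nhds) key

lemma tau_le {ξ : Ω → ℝ} {a : ℝ} (ha : 0 ≤ a) (h : ExpBound φ P ξ a) :
    tau φ P ξ ≤ ENNReal.ofReal a :=
  sInf_le ⟨a, ha, h, rfl⟩

lemma secondMoment_eq (ξ : Ω → ℝ) : secondMoment P ξ = eLpNorm ξ 2 P ^ (2 : ℝ) := by
  have h := eLpNorm_nnreal_pow_eq_lintegral (f := ξ) (μ := P) (p := 2) (by norm_num)
  simp only [NNReal.coe_ofNat, ENNReal.coe_ofNat] at h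
  rw [h, secondMoment]
  refine lintegral_congr fun ω => ?_
  rw [Real.enorm_eq_ofReal_abs, ENNReal.ofReal_rpow_of_nonneg (abs_nonneg _) (by norm_num),
    Real.rpow_two, sq_abs]

lemma secondMoment_rpow_half (ξ : Ω → ℝ) :
    secondMoment P ξ ^ (1 / 2 : ℝ) = eLpNorm ξ 2 P := by
  rw [secondMoment_eq, ← ENNReal.rpow_mul]
  norm_num

lemma secondMoment_rpow_div_two (ξ : Ω → ℝ) (p : ℝ) :
    secondMoment P ξ ^ (p / 2) = eLpNorm ξ 2 P ^ p := by
  rw [secondMoment_eq, ← ENNReal.rpow_mul]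
  congr 1
  ring

/-- `E exp (x |ξ| / b) ≤ 2 exp (φ x)` if `τ_φ(ξ) ≤ b`. -/
lemma ExpBound.lintegral_exp_abs_le (hφ : IsOrliczN φ) {ξ : Ω → ℝ} (hξ : AEMeasurable ξ P)
    {b x : ℝ} (hb : 0 < b) (h : ExpBound φ P ξ b) :
    ∫⁻ ω, ENNReal.ofReal (Real.exp (x * (|ξ ω| / b))) ∂P
      ≤ ENNReal.ofReal (2 * Real.exp (φ x)) := by
  have hpt : ∀ ω, ENNReal.ofReal (Real.exp (x * (|ξ ω| / b)))
      ≤ ENNReal.ofReal (Real.exp ((x / b) * ξ ω))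
        + ENNReal.ofReal (Real.exp ((-x / b) * ξ ω)) := fun ω => by
    rw [← ENNReal.ofReal_add (Real.exp_pos _).le (Real.exp_pos _).le]
    refine ENNReal.ofReal_le_ofReal ?_
    rcases abs_choice (ξ ω) with hω | hω <;> rw [hω]
    · rw [show x * (ξ ω / b) = x / b * ξ ω by ring]
      linarith [Real.exp_pos (-x / b * ξ ω)]
    · rw [show x * (-ξ ω / b) = -x / b * ξ ω by ring]
      linarith [Real.exp_pos (x / b * ξ ω)]
  have h1 := h (x / b)
  have h2 := h (-x / b)
  rw [mul_div_cancel₀ _ hb.ne'] at h1 h2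
  rw [hφ.even] at h2
  calc _ ≤ _ := lintegral_mono hpt
    _ = _ := lintegral_add_left' (by fun_prop) _
    _ ≤ _ := add_le_add h1 h2
    _ = _ := by
      rw [← ENNReal.ofReal_add (Real.exp_pos _).le (Real.exp_pos _).le, two_mul]

/-- From `r ^ 2 / 2 ≤ exp r` with `r = |ξ| / b`, and the preceding bound at `x = 1`. A uniform bound
on `τ_φ` thereby becomes a uniform mean square bound. -/
lemma ExpBound.eLpNorm_le (hφ : IsOrliczN φ) {ξ : Ω → ℝ} (hξ : AEMeasurable ξ P)
    {b : ℝ} (hb : 0 < b) (h : ExpBound φ P ξ b) :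
    eLpNorm ξ 2 P ≤ ENNReal.ofReal (2 * b ^ 2 * (2 * Real.exp (φ 1))) ^ (1 / 2 : ℝ) := by
  rw [← secondMoment_rpow_half]
  refine ENNReal.rpow_le_rpow ?_ (by norm_num)
  have hpt : ∀ ω, ENNReal.ofReal (ξ ω ^ 2)
      ≤ ENNReal.ofReal (2 * b ^ 2) * ENNReal.ofReal (Real.exp (1 * (|ξ ω| / b))) := fun ω => by
    rw [← ENNReal.ofReal_mul (by positivity)]
    refine ENNReal.ofReal_le_ofReal ?_
    have hr : 0 ≤ |ξ ω| / b := by positivity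
    have := Real.quadratic_le_exp_of_nonneg hr
    have e : ξ ω ^ 2 = b ^ 2 * (|ξ ω| / b) ^ 2 := by
      rw [div_pow, sq_abs]; field_simp
    rw [e, one_mul]
    nlinarith [sq_nonneg b]
  calc secondMoment P ξ ≤ _ := lintegral_mono hpt
    _ = _ := lintegral_const_mul' _ _ ENNReal.ofReal_ne_top
    _ ≤ _ := mul_le_mul_right (h.lintegral_exp_abs_le hφ hξ hb) _
    _ = _ := (ENNReal.ofReal_mul (by positivity)).symm

lemma IsSub.memLp (hφ : IsOrliczN φ) {ξ : Ω → ℝ} (h : IsSub φ P ξ) : MemLp ξ 2 P := by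
  obtain ⟨r, hr, hE⟩ := h.bound
  refine ⟨h.meas.aestronglyMeasurable, ?_⟩
  refine ((hE.mono hφ hr (by linarith : r ≤ r + 1)).eLpNorm_le hφ h.meas.aemeasurable
    (by positivity)).trans_lt ?_
  exact ENNReal.rpow_lt_top_of_nonneg (by norm_num) ENNReal.ofReal_ne_top

end ExponentialBounds

/-! ### The closed linear span of the process in L₂(Ω). -/

section ClosedSpan

variable {Ω : Type*} [MeasurableSpace Ω] {P : Measure Ω} {φ : ℝ → ℝ} {X : ℝ → Ω → ℝ} {C : ℝ}

/-- The closed linear span in `L₂(Ω)` of the values of a process. -/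
noncomputable def closedSpan (P : Measure Ω) (X : ℝ → Ω → ℝ) : Submodule ℝ (Lp ℝ 2 P) :=
  (Submodule.span ℝ (Set.range fun t => toL2 P (X t))).topologicalClosure

/-- A closed subspace of a Hilbert space contains the integrals of functions with values
in it. -/
lemma integral_mem_of_isClosed {H α : Type*} [NormedAddCommGroup H] [InnerProductSpace ℝ H]
    [CompleteSpace H] [MeasurableSpace α] {μ : Measure α} {K : Submodule ℝ H}
    (hK : IsClosed (K : Set H)) {g : α → H} (hg : ∀ a, g a ∈ K) : ∫ a, g a ∂μ ∈ K := by
  by_cases hi : Integrable g μ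
  -- The orthogonal projection onto `K` commutes with the integral and fixes the integrand, so it
  -- fixes the integral.
  · have : CompleteSpace K := hK.completeSpace_coe
    have h := K.starProjection.integral_comp_comm hi
    simp_rw [fun a => Submodule.starProjection_eq_self_iff.2 (hg a)] at h
    exact Submodule.starProjection_eq_self_iff.1 h.symm
  · rw [integral_undef hi]
    exact K.zero_mem

lemma toL2_mem_closedSpan (t : ℝ) : toL2 P (X t) ∈ closedSpan P X :=
  Submodule.le_topologicalClosure _ (Submodule.subset_span ⟨t, rfl⟩)

/-- No integrability is needed: the default value `0` of an undefined integral also lies in the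
subspace. -/
lemma msIntegral_mem_closedSpan (g : ℝ → ℝ) : msIntegral P X g ∈ closedSpan P X :=
  integral_mem_of_isClosed (Submodule.isClosed_topologicalClosure _) fun t =>
    Submodule.smul_mem _ _ (toL2_mem_closedSpan t)

lemma coeFn_toL2 {Y : Ω → ℝ} (h : MemLp Y 2 P) : toL2 P Y =ᵐ[P] Y := by
  rw [toL2, dif_pos h]
  exact h.coeFn_toLp

lemma coeFn_lp_sum {m : ℕ} (g : Fin m → Lp ℝ 2 P) (lam : Fin m → ℝ) :
    ⇑(∑ i, lam i • g i) =ᵐ[P] fun ω => ∑ i, lam i * g i ω := by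
  have h1 : ∀ᵐ ω ∂P, ∀ i, (lam i • g i : Lp ℝ 2 P) ω = lam i * g i ω :=
    ae_all_iff.2 fun i => Lp.coeFn_smul (lam i) (g i)
  filter_upwards [h1, Lp.coeFn_finsetSum Finset.univ fun i => lam i • g i] with ω h h'
  rw [h', Finset.sum_apply]
  exact Finset.sum_congr rfl fun i _ => h i

/-- An element of the span is a.e. a finite combination of values of `X`; strictness bounds its
`τ_φ` by `C` times its L₂ norm, and the infimum in `τ_φ` is attained. -/
lemma expBound_of_mem_span (hφ : IsOrliczN φ) (hX : IsStrictlySubFamily φ P (Set.range X) C)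
    {g : Lp ℝ 2 P} (hg : g ∈ Submodule.span ℝ (Set.range fun t => toL2 P (X t))) :
    ExpBound φ P g (C * ‖g‖) := by
  obtain ⟨hC, hsub, hstrict⟩ := hX
  obtain ⟨m, lam, y, rfl⟩ := Submodule.mem_span_set'.1 hg
  choose t ht using fun i => (y i).2
  have hae : ⇑(∑ i, lam i • (y i : Lp ℝ 2 P)) =ᵐ[P] fun ω => ∑ i, lam i * X (t i) ω := by
    have h1 : ∀ᵐ ω ∂P, ∀ i, (y i : Lp ℝ 2 P) ω = X (t i) ω := ae_all_iff.2 fun i => by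
      have := coeFn_toL2 ((hsub _ ⟨t i, rfl⟩).memLp hφ)
      rwa [show toL2 P (X (t i)) = (y i : Lp ℝ 2 P) from ht i] at this
    filter_upwards [h1, coeFn_lp_sum (fun i => (y i : Lp ℝ 2 P)) lam] with ω h h'
    rw [h']
    exact Finset.sum_congr rfl fun i _ => by rw [h i]
  refine ExpBound.congr (expBound_of_tau_le hφ (by positivity) ?_) hae
  refine (hstrict m (fun i => X (t i)) (fun i => ⟨t i, rfl⟩) lam).trans_eq ?_
  rw [secondMoment_rpow_half, ← eLpNorm_congr_ae hae, ENNReal.ofReal_mul hC.le, Lp.norm_def,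
    ENNReal.ofReal_toReal (Lp.eLpNorm_ne_top _)]

/-- The bound on the exponential moments passes to limits in `L₂(Ω)`. -/
lemma expBound_of_mem_closedSpan (hφ : IsOrliczN φ)
    (hX : IsStrictlySubFamily φ P (Set.range X) C)
    {g : Lp ℝ 2 P} (hg : g ∈ closedSpan P X) : ExpBound φ P g (C * ‖g‖) := by
  intro lam
  obtain ⟨u, hu, hlim⟩ := mem_closure_iff_seq_limit.1 hg
  obtain ⟨ns, hns, hae⟩ := (tendstoInMeasure_of_tendsto_Lp hlim).exists_seq_tendsto_ae
  have hcont : Continuous fun z : ℝ => ENNReal.ofReal (Real.exp (lam * z)) :=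
    ENNReal.continuous_ofReal.comp (by fun_prop)
  have hcont' : Continuous fun b : ℝ => ENNReal.ofReal (Real.exp (φ (C * b * lam))) :=
    ENNReal.continuous_ofReal.comp (Real.continuous_exp.comp (hφ.cont.comp (by fun_prop)))
  have hnorm : Tendsto (fun i => ENNReal.ofReal (Real.exp (φ (C * ‖u (ns i)‖ * lam)))) atTop
      (𝓝 (ENNReal.ofReal (Real.exp (φ (C * ‖g‖ * lam))))) :=
    (hcont'.tendsto _).comp ((hlim.comp hns.tendsto_atTop).norm)
  -- Fatou's lemma along the a.e. convergent subsequence; the right-hand bounds converge because the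
  -- norms do.
  calc ∫⁻ ω, ENNReal.ofReal (Real.exp (lam * g ω)) ∂P
      = ∫⁻ ω, liminf (fun i => ENNReal.ofReal (Real.exp (lam * u (ns i) ω))) atTop ∂P := by
        refine lintegral_congr_ae ?_
        filter_upwards [hae] with ω hω
        exact ((hcont.tendsto _).comp hω).liminf_eq.symm
    _ ≤ liminf (fun i => ∫⁻ ω, ENNReal.ofReal (Real.exp (lam * u (ns i) ω)) ∂P) atTop :=
        lintegral_liminf_le fun i =>
          hcont.measurable.comp (Lp.stronglyMeasurable (u (ns i))).measurable
    _ ≤ liminf (fun i => ENNReal.ofReal (Real.exp (φ (C * ‖u (ns i)‖ * lam)))) atTop :=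
        liminf_le_liminf (Eventually.of_forall fun i => expBound_of_mem_span hφ hX (hu _) lam)
    _ = _ := hnorm.liminf_eq

/-- The random variable `Y` represents an element of the closed linear span of `X`. -/
def InClosedSpan (P : Measure Ω) (X : ℝ → Ω → ℝ) (Y : Ω → ℝ) : Prop :=
  ∃ g ∈ closedSpan P X, Y =ᵐ[P] g

lemma InClosedSpan.aemeasurable {Y : Ω → ℝ} (h : InClosedSpan P X Y) : AEMeasurable Y P := by
  obtain ⟨g, -, hg⟩ := h
  exact (Lp.stronglyMeasurable g).measurable.aemeasurable.congr hg.symm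

lemma InClosedSpan.add {Y Z : Ω → ℝ} (hY : InClosedSpan P X Y) (hZ : InClosedSpan P X Z) :
    InClosedSpan P X fun ω => Y ω + Z ω := by
  obtain ⟨g, hg, hYg⟩ := hY
  obtain ⟨h, hh, hZh⟩ := hZ
  refine ⟨g + h, Submodule.add_mem _ hg hh, ?_⟩
  filter_upwards [hYg, hZh, Lp.coeFn_add g h] with ω h1 h2 h3
  rw [h3, Pi.add_apply, h1, h2]

lemma InClosedSpan.mul_const {Y : Ω → ℝ} (hY : InClosedSpan P X Y) (a : ℝ) :
    InClosedSpan P X fun ω => Y ω * a := by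
  obtain ⟨g, hg, hYg⟩ := hY
  refine ⟨a • g, Submodule.smul_mem _ _ hg, ?_⟩
  filter_upwards [hYg, Lp.coeFn_smul a g] with ω h1 h3
  rw [h3, Pi.smul_apply, h1, smul_eq_mul, mul_comm]

lemma InClosedSpan.expBound (hφ : IsOrliczN φ) (hX : IsStrictlySubFamily φ P (Set.range X) C)
    {Y : Ω → ℝ} (hY : InClosedSpan P X Y) : ExpBound φ P Y (C * (eLpNorm Y 2 P).toReal) := by
  obtain ⟨g, hg, hYg⟩ := hY
  rw [eLpNorm_congr_ae hYg, ← Lp.norm_def]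
  exact (expBound_of_mem_closedSpan hφ hX hg).congr hYg

lemma InClosedSpan.tau_le (hφ : IsOrliczN φ) (hX : IsStrictlySubFamily φ P (Set.range X) C)
    {Y : Ω → ℝ} (hY : InClosedSpan P X Y) :
    tau φ P Y ≤ ENNReal.ofReal C * eLpNorm Y 2 P := by
  have hC := hX.1.le
  refine (PhiSub.tau_le (by positivity) (hY.expBound hφ hX)).trans ?_
  rw [ENNReal.ofReal_mul hC]
  gcongr
  exact ENNReal.ofReal_toReal_le

/-- The `p`-th powers of the norms `τ_φ` and of the mean square norms, compared on `[0, T]`. -/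
lemma lintegral_tau_rpow_le (hφ : IsOrliczN φ)
    (hX : IsStrictlySubFamily φ P (Set.range X) C) {T p : ℝ} (hp : 0 ≤ p)
    {G : ℝ → Ω → ℝ} (hG : ∀ t, InClosedSpan P X (G t)) :
    ∫⁻ t in Set.Icc 0 T, tau φ P (G t) ^ p
      ≤ ENNReal.ofReal C ^ p * ∫⁻ t in Set.Icc 0 T, secondMoment P (G t) ^ (p / 2) := by
  rw [← lintegral_const_mul' _ _ (ENNReal.rpow_ne_top_of_nonneg hp ENNReal.ofReal_ne_top)]
  refine lintegral_mono fun t => ?_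
  rw [secondMoment_rpow_div_two, ← ENNReal.mul_rpow_of_nonneg _ _ hp]
  exact ENNReal.rpow_le_rpow ((hG t).tau_le hφ hX) hp

end ClosedSpan

/-! ### Span-valued processes with mean square norm bounded on `[0, T]`. -/

section TailBound

variable {Ω : Type*} [MeasurableSpace Ω] {P : Measure Ω} {φ : ℝ → ℝ} {X : ℝ → Ω → ℝ} {C T : ℝ}

/-- A measurable process with values in the closed linear span of `X` whose mean square norm is
bounded on `[0, T]`. -/
structure IsSpanProcess (P : Measure Ω) (X : ℝ → Ω → ℝ) (T : ℝ) (G : ℝ → Ω → ℝ) : Prop where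
  meas : Measurable (Function.uncurry G)
  mem : ∀ t, InClosedSpan P X (G t)
  bdd : ∃ B : ℝ≥0, ∀ t ∈ Set.Icc 0 T, eLpNorm (G t) 2 P ≤ B

lemma IsSpanProcess.add {G H : ℝ → Ω → ℝ} (hG : IsSpanProcess P X T G)
    (hH : IsSpanProcess P X T H) : IsSpanProcess P X T fun t ω => G t ω + H t ω where
  meas := hG.meas.add hH.meas
  mem t := (hG.mem t).add (hH.mem t)
  bdd := by
    obtain ⟨B, hB⟩ := hG.bdd
    obtain ⟨D, hD⟩ := hH.bdd
    refine ⟨B + D, fun t ht => ?_⟩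
    rw [ENNReal.coe_add]
    exact (eLpNorm_add_le (hG.mem t).aemeasurable.aestronglyMeasurable
      (hH.mem t).aemeasurable.aestronglyMeasurable (by norm_num)).trans
        (add_le_add (hB t ht) (hD t ht))

lemma IsSpanProcess.neg {G : ℝ → Ω → ℝ} (hG : IsSpanProcess P X T G) :
    IsSpanProcess P X T fun t ω => -G t ω where
  meas := hG.meas.neg
  mem t := by simpa using (hG.mem t).mul_const (-1)
  bdd := by
    obtain ⟨B, hB⟩ := hG.bdd
    exact ⟨B, fun t ht => (eLpNorm_neg (G t) 2 P).trans_le (hB t ht)⟩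

lemma IsSpanProcess.sub {G H : ℝ → Ω → ℝ} (hG : IsSpanProcess P X T G)
    (hH : IsSpanProcess P X T H) : IsSpanProcess P X T fun t ω => G t ω - H t ω := by
  simpa only [sub_eq_add_neg] using hG.add hH.neg

lemma IsSpanProcess.zero : IsSpanProcess P X T fun _ _ => 0 where
  meas := measurable_const
  mem _ := ⟨0, Submodule.zero_mem _, (Lp.coeFn_zero ℝ 2 P).symm⟩
  bdd := ⟨0, fun _ _ => by simp⟩

lemma IsSpanProcess.sum {ι : Type*} (s : Finset ι) {G : ι → ℝ → Ω → ℝ}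
    (hG : ∀ i, IsSpanProcess P X T (G i)) :
    IsSpanProcess P X T fun t ω => ∑ i ∈ s, G i t ω := by
  classical
  induction s using Finset.induction_on with
  | empty => simpa using IsSpanProcess.zero
  | insert i s hi ih => simpa only [Finset.sum_insert hi] using (hG i).add ih

/-- Continuity of `h` supplies both joint measurability and boundedness on the compact interval. -/
lemma isSpanProcess_mul {g : Lp ℝ 2 P} (hg : g ∈ closedSpan P X) {h : ℝ → ℝ}
    (hh : Continuous h) : IsSpanProcess P X T fun t ω => g ω * h t where
  meas := ((Lp.stronglyMeasurable g).measurable.comp measurable_snd).mul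
    (hh.measurable.comp measurable_fst)
  mem t := InClosedSpan.mul_const ⟨g, hg, ae_eq_refl _⟩ (h t)
  bdd := by
    obtain ⟨B, hB⟩ := (isCompact_Icc (a := (0 : ℝ)) (b := T)).exists_bound_of_continuousOn
      hh.continuousOn
    refine ⟨(B.toNNReal : ℝ≥0) * ‖g‖₊, fun t ht => ?_⟩
    have e : (fun ω => g ω * h t) = h t • (g : Ω → ℝ) := by
      ext ω; simp [mul_comm]
    rw [e, eLpNorm_const_smul, ENNReal.coe_mul, Lp.nnnorm_def,
      ENNReal.coe_toNNReal (Lp.eLpNorm_ne_top _)]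
    gcongr
    rw [← ofReal_norm]
    exact ENNReal.ofReal_le_ofReal (hB t ht)

lemma continuous_dil {δ : ℝ → ℝ} (hδ : Continuous δ) (j : ℕ) (k : ℤ) :
    Continuous (dil δ j k) :=
  continuous_const.mul (hδ.comp (by fun_prop))

lemma isSpanProcess_approx {w v : ℝ → ℝ} (hw : Continuous w) (hv : Continuous v)
    (n k' : ℕ) (kk : ℕ → ℕ) : IsSpanProcess P X T (approx P w v X n k' kk) :=
  (IsSpanProcess.sum _ fun k =>
    isSpanProcess_mul (msIntegral_mem_closedSpan _) (continuous_dil hw 0 k)).add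
  (IsSpanProcess.sum _ fun j => IsSpanProcess.sum _ fun k =>
    isSpanProcess_mul (msIntegral_mem_closedSpan _) (continuous_dil hv j k))

lemma inClosedSpan_self (hφ : IsOrliczN φ) (hX : IsStrictlySubFamily φ P (Set.range X) C)
    (t : ℝ) : InClosedSpan P X (X t) :=
  ⟨_, toL2_mem_closedSpan t, (coeFn_toL2 ((hX.2.1 _ ⟨t, rfl⟩).memLp hφ)).symm⟩

lemma isSpanProcess_self (hφ : IsOrliczN φ) (hX : IsStrictlySubFamily φ P (Set.range X) C)
    (hXmeas : Measurable (Function.uncurry X)) {c A : ℝ → ℝ} (hc : IsWeight c A)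
    (hXc : ∀ t, tau φ P (X t) ≤ ENNReal.ofReal (c t)) : IsSpanProcess P X T X where
  meas := hXmeas
  mem := inClosedSpan_self hφ hX
  bdd := by
    rcases lt_or_ge T 0 with hT | hT
    · exact ⟨0, fun t ht => absurd (ht.1.trans ht.2) hT.not_ge⟩
    -- Since `c` is nondecreasing on `[0, ∞)`, the single positive constant `c T` bounds `τ_φ (X t)`
    -- for every `t` in `[0, T]`.
    have hcT : 0 < c T := by
      linarith [hc.one_lt, hc.mono Set.self_mem_Ici (Set.mem_Ici.2 hT) hT]
    refine ⟨_, fun t ht => (((expBound_of_tau_le hφ hcT.le ((hXc t).trans ?_)).eLpNorm_le hφ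
      (inClosedSpan_self hφ hX t).aemeasurable hcT).trans_eq
        (ENNReal.coe_toNNReal ?_).symm)⟩
    · exact ENNReal.ofReal_le_ofReal (hc.mono ht.1 (ht.1.trans ht.2) ht.2)
    · exact ENNReal.rpow_ne_top_of_nonneg (by norm_num) ENNReal.ofReal_ne_top

lemma IsSpanProcess.lintegral_lt_top {G : ℝ → Ω → ℝ} (hG : IsSpanProcess P X T G) {p : ℝ}
    (hp : 0 ≤ p) : ∫⁻ t in Set.Icc 0 T, secondMoment P (G t) ^ (p / 2) < ∞ := by
  obtain ⟨B, hB⟩ := hG.bdd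
  simp_rw [secondMoment_rpow_div_two]
  calc _ ≤ ∫⁻ _ in Set.Icc 0 T, (B : ℝ≥0∞) ^ p :=
        setLIntegral_mono' measurableSet_Icc fun t ht => ENNReal.rpow_le_rpow (hB t ht) hp
    _ < ∞ := by
        rw [setLIntegral_const, Real.volume_Icc]
        exact ENNReal.mul_lt_top (ENNReal.rpow_lt_top_of_nonneg hp ENNReal.coe_ne_top)
          ENNReal.ofReal_lt_top

/-! ### The exponential tail estimate. -/

/-- The tangent inequality for `r ^ p ↦ exp (s r)` at `r = 1`. -/
lemma mul_rpow_le_exp_add {p s r : ℝ} (hp : 0 < p) (hps : p ≤ s) (hr : 0 ≤ r) :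
    Real.exp s * (s / p) * r ^ p ≤ Real.exp (s * r) + Real.exp s * (s / p - 1) := by
  have hs : 0 < s := hp.trans_le hps
  -- Bernoulli's inequality with exponent `s / p ≥ 1`; this is where `p ≤ s` enters.
  have h1 : 1 + s / p * (r ^ p - 1) ≤ (1 + (r ^ p - 1)) ^ (s / p) :=
    one_add_mul_self_le_rpow_one_add (by linarith [Real.rpow_nonneg hr p])
      ((one_le_div hp).2 hps)
  have h2 : (1 + (r ^ p - 1)) ^ (s / p) = r ^ s := by
    rw [add_sub_cancel, ← Real.rpow_mul hr, mul_div_cancel₀ _ hp.ne']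
  have h3 : r ^ s ≤ Real.exp (s * (r - 1)) := by
    rw [mul_comm, Real.exp_mul]
    exact Real.rpow_le_rpow hr (by linarith [Real.add_one_le_exp (r - 1)]) hs.le
  have h4 : Real.exp (s * r) = Real.exp s * Real.exp (s * (r - 1)) := by
    rw [← Real.exp_add]; ring_nf
  rw [h4]
  nlinarith [Real.exp_pos s]

/-- The tangent inequality at `r = |y| / (b u)`, multiplied by `b ^ p / c`. For `b = 0` the
assumption `y = 0` makes both sides vanish. -/
lemma mul_rpow_le_mul_exp_add {p c ε u x b y : ℝ} (hp : 0 < p) (hc : 0 < c) (hu0 : 0 < u)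
    (hup : u ^ p = ε / c) (hx : p ≤ u * x) (hb : 0 ≤ b) (h0 : b = 0 → y = 0) :
    ENNReal.ofReal (Real.exp (u * x) * (u * x / p) / ε) * ENNReal.ofReal (|y| ^ p)
      ≤ ENNReal.ofReal (b ^ p / c) * ENNReal.ofReal (Real.exp (x * (|y| / b)))
        + ENNReal.ofReal (Real.exp (u * x) * (u * x / p - 1) / c) * ENNReal.ofReal (b ^ p) := by
  have hε : 0 < ε := (div_pos_iff_of_pos_right hc).1 (hup ▸ Real.rpow_pos_of_pos hu0 p)
  have hs0 : 0 < u * x := hp.trans_le hx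
  have hK : 0 ≤ Real.exp (u * x) * (u * x / p - 1) / c := by
    have := (one_le_div hp).2 hx
    exact div_nonneg (mul_nonneg (Real.exp_pos _).le (by linarith)) hc.le
  have hbp := Real.rpow_nonneg hb p
  have hyp := Real.rpow_nonneg (abs_nonneg y) p
  rw [← ENNReal.ofReal_mul (by positivity), ← ENNReal.ofReal_mul (by positivity),
    ← ENNReal.ofReal_mul hK, ← ENNReal.ofReal_add (by positivity) (mul_nonneg hK hbp)]
  refine ENNReal.ofReal_le_ofReal ?_
  rcases hb.eq_or_lt with hb' | hb'
  · rw [h0 hb'.symm, ← hb', abs_zero, Real.zero_rpow hp.ne']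
    simp
  · have h := mul_le_mul_of_nonneg_left
      (mul_rpow_le_exp_add (r := |y| / b / u) hp hx (by positivity))
      (show 0 ≤ b ^ p / c by positivity)
    have e1 : u * x * (|y| / b / u) = x * (|y| / b) := by field_simp
    rw [Real.div_rpow (by positivity) hu0.le, Real.div_rpow (abs_nonneg _) hb'.le, hup, e1] at h
    have hbp' : 0 < b ^ p := Real.rpow_pos_of_pos hb' p
    have e2 : Real.exp (u * x) * (u * x / p) / ε * |y| ^ p
        = b ^ p / c * (Real.exp (u * x) * (u * x / p) * (|y| ^ p / b ^ p / (ε / c))) := by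
      field_simp
    rw [e2]
    exact h.trans_eq (by ring)

/-- The tail of `∫ |G t| ^ p` under a pointwise bound `b` of the norms `τ_φ(G t)`. -/
lemma measure_lt_lintegral_le [IsProbabilityMeasure P] (hφ : IsOrliczN φ) {α : Type*}
    [MeasurableSpace α] {μ : Measure α} [SFinite μ] {G : α → Ω → ℝ}
    (hG : Measurable (Function.uncurry G)) {b : α → ℝ} (hb : Measurable b) (hb0 : ∀ t, 0 ≤ b t)
    (hE : ∀ᵐ t ∂μ, ExpBound φ P (G t) (b t))
    (hz : ∀ᵐ t ∂μ, b t = 0 → G t =ᵐ[P] 0) {p c ε x : ℝ} (hp : 0 < p) (hc : 0 < c)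
    (hbc : ∫⁻ t, ENNReal.ofReal (b t ^ p) ∂μ = ENNReal.ofReal c) (hε : 0 < ε)
    (hx : p ≤ (ε / c) ^ (1 / p) * x) :
    P {ω | ENNReal.ofReal ε < ∫⁻ t, ENNReal.ofReal (|G t ω| ^ p) ∂μ}
      ≤ ENNReal.ofReal (2 * Real.exp (-((ε / c) ^ (1 / p) * x - φ x))) := by
  set u : ℝ := (ε / c) ^ (1 / p) with hu
  have hu0 : 0 < u := by positivity
  have hup : u ^ p = ε / c := by
    rw [hu, ← Real.rpow_mul (by positivity), one_div_mul_cancel hp.ne', Real.rpow_one]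
  set s : ℝ := u * x with hs
  have hs0 : 0 < s := hp.trans_le hx
  -- The weight `b ^ p / c` has total mass one by `hbc`.
  set F : α → Ω → ℝ≥0∞ := fun t ω =>
    ENNReal.ofReal (b t ^ p / c) * ENNReal.ofReal (Real.exp (x * (|G t ω| / b t))) with hF
  have hG1 : Measurable fun q : α × Ω => G q.1 q.2 := hG
  have hFm : Measurable (Function.uncurry F) := by
    change Measurable fun q : α × Ω => ENNReal.ofReal (b q.1 ^ p / c)
      * ENNReal.ofReal (Real.exp (x * (|G q.1 q.2| / b q.1)))
    fun_prop
  have hK : (0 : ℝ) ≤ Real.exp s * (s / p - 1) := by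
    have := (one_le_div hp).2 hx
    exact mul_nonneg (Real.exp_pos s).le (by linarith)
  have hpt : ∀ t ω, (b t = 0 → G t ω = 0) →
      ENNReal.ofReal (Real.exp s * (s / p) / ε) * ENNReal.ofReal (|G t ω| ^ p)
        ≤ F t ω + ENNReal.ofReal (Real.exp s * (s / p - 1) / c) * ENNReal.ofReal (b t ^ p) :=
    fun t ω h0 => mul_rpow_le_mul_exp_add hp hc hu0 hup hx (hb0 t) h0
  -- Where `b t = 0` the weight carries no information, so `G` must vanish there. The hypothesis
  -- gives this for almost every `t`, almost surely; Fubini for null sets exchanges the quantifiers.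
  have hzero : ∀ᵐ ω ∂P, ∀ᵐ t ∂μ, b t = 0 → G t ω = 0 := by
    have hm : MeasurableSet {q : α × Ω | b q.1 = 0 → G q.1 q.2 = 0} := by
      have h1 : MeasurableSet {q : α × Ω | b q.1 = 0} :=
        (hb.comp measurable_fst) (measurableSet_singleton 0)
      have h2 : MeasurableSet {q : α × Ω | G q.1 q.2 = 0} := hG1 (measurableSet_singleton 0)
      exact h1.imp h2
    refine (Measure.ae_ae_comm (p := fun t ω => b t = 0 → G t ω = 0) hm).1 ?_
    filter_upwards [hz] with t ht
    by_cases hbt : b t = 0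
    · filter_upwards [ht hbt] with ω hω _ using hω
    · exact Eventually.of_forall fun ω h => absurd h hbt
  -- the exponential integral is large on the event
  have hsub : ∀ᵐ ω ∂P, ENNReal.ofReal ε < ∫⁻ t, ENNReal.ofReal (|G t ω| ^ p) ∂μ →
      ENNReal.ofReal (Real.exp s) ≤ ∫⁻ t, F t ω ∂μ := by
    filter_upwards [hzero] with ω hω hlt
    have h1 : ENNReal.ofReal (Real.exp s * (s / p) / ε)
          * ∫⁻ t, ENNReal.ofReal (|G t ω| ^ p) ∂μ
        ≤ ∫⁻ t, F t ω ∂μ + ENNReal.ofReal (Real.exp s * (s / p - 1)) := by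
      rw [← lintegral_const_mul' _ _ ENNReal.ofReal_ne_top]
      refine (lintegral_mono_ae (hω.mono fun t ht => hpt t ω ht)).trans_eq ?_
      have hFω : Measurable fun t => F t ω := hFm.of_uncurry_right
      rw [lintegral_add_left hFω,
        lintegral_const_mul' _ _ ENNReal.ofReal_ne_top, hbc,
        ← ENNReal.ofReal_mul (by positivity), div_mul_cancel₀ _ hc.ne']
    -- On the event the left side of `h1` is at least `exp s * (s / p)`, which splits as `exp s`
    -- plus the finite constant to be cancelled.
    have h2 : ENNReal.ofReal (Real.exp s) + ENNReal.ofReal (Real.exp s * (s / p - 1))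
        ≤ ENNReal.ofReal (Real.exp s * (s / p) / ε)
          * ∫⁻ t, ENNReal.ofReal (|G t ω| ^ p) ∂μ := by
      refine le_trans (le_of_eq ?_) (mul_le_mul_right hlt.le _)
      rw [← ENNReal.ofReal_add (Real.exp_pos s).le hK, ← ENNReal.ofReal_mul (by positivity),
        div_mul_cancel₀ _ hε.ne']
      congr 1
      ring
    exact (ENNReal.add_le_add_iff_right ENNReal.ofReal_ne_top).1 (h2.trans h1)
  -- its expectation
  have hexp : ∫⁻ ω, ∫⁻ t, F t ω ∂μ ∂P ≤ ENNReal.ofReal (2 * Real.exp (φ x)) := by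
    rw [← lintegral_lintegral_swap hFm.aemeasurable]
    have h1 : ∀ᵐ t ∂μ, ∫⁻ ω, F t ω ∂P
        ≤ ENNReal.ofReal (2 * Real.exp (φ x) / c) * ENNReal.ofReal (b t ^ p) := by
      filter_upwards [hE] with t ht
      have hbp := Real.rpow_nonneg (hb0 t) p
      rw [hF]
      dsimp only
      rw [lintegral_const_mul' _ _ ENNReal.ofReal_ne_top]
      rcases (hb0 t).eq_or_lt with hb' | hb'
      · rw [← hb', Real.zero_rpow hp.ne']
        simp
      · refine (mul_le_mul_right (ht.lintegral_exp_abs_le hφ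
          (hG.comp measurable_prodMk_left).aemeasurable hb') _).trans_eq ?_
        rw [← ENNReal.ofReal_mul (by positivity), ← ENNReal.ofReal_mul (by positivity)]
        congr 1
        ring
    refine (lintegral_mono_ae h1).trans_eq ?_
    rw [lintegral_const_mul' _ _ ENNReal.ofReal_ne_top, hbc, ← ENNReal.ofReal_mul (by positivity),
      div_mul_cancel₀ _ hc.ne']
  calc _ ≤ P {ω | ENNReal.ofReal (Real.exp s) ≤ ∫⁻ t, F t ω ∂μ} := measure_mono_ae hsub
    _ ≤ (∫⁻ ω, ∫⁻ t, F t ω ∂μ ∂P) / ENNReal.ofReal (Real.exp s) :=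
        meas_ge_le_lintegral_div hFm.lintegral_prod_left'.aemeasurable
          (ENNReal.ofReal_pos.2 (Real.exp_pos s)).ne' ENNReal.ofReal_ne_top
    _ ≤ ENNReal.ofReal (2 * Real.exp (φ x)) / ENNReal.ofReal (Real.exp s) :=
        ENNReal.div_le_div_right hexp _
    _ = _ := by
        rw [← ENNReal.ofReal_div_of_pos (Real.exp_pos s), neg_sub, Real.exp_sub, mul_div_assoc]

/-- A bound by `2 exp (-(u x - φ x))` for all large `x` gives the bound with the transform. -/
lemma le_two_mul_exp_neg_youngFenchel (hφ : IsOrliczN φ) {f : ℝ → ℝ} (hf : IsDensity φ f)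
    {q : ℝ≥0∞} {u x₀ : ℝ} (hu : 0 ≤ u) (hfu : f x₀ ≤ u)
    (h : ∀ x, x₀ ≤ x → q ≤ ENNReal.ofReal (2 * Real.exp (-(u * x - φ x)))) :
    q ≤ ENNReal.ofReal (2 * Real.exp (-youngFenchel φ u)) := by
  have hqtop : q ≠ ∞ := ((h x₀ le_rfl).trans_lt ENNReal.ofReal_lt_top).ne
  rcases eq_or_ne q 0 with hq | hq
  -- The remaining case has `q > 0`, so taking logarithms turns the hypothesis into an upper bound
  -- on `u * x - φ x`.
  · simp [hq]
  have hq0 : 0 < q.toReal := ENNReal.toReal_pos hq hqtop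
  have hbd : ∀ x, x₀ ≤ x → u * x - φ x ≤ -Real.log (q.toReal / 2) := fun x hx => by
    have h1 := ENNReal.toReal_le_of_le_ofReal (by positivity) (h x hx)
    have h2 : Real.log (q.toReal / 2) ≤ -(u * x - φ x) := by
      rw [Real.log_le_iff_le_exp (by positivity)]
      linarith
    linarith
  have hsup : youngFenchel φ u ≤ -Real.log (q.toReal / 2) := by
    refine ciSup_le fun y => ?_
    have h1 : u * y - φ y ≤ u * |y| - φ |y| := by
      rw [hφ.map_abs]
      have := mul_le_mul_of_nonneg_left (le_abs_self y) hu
      linarith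
    -- Below `x₀` the density is at most `u`, so the value at `x₀` dominates; above `x₀` the
    -- hypothesis applies directly.
    rcases le_total |y| x₀ with hy | hy
    · exact h1.trans ((hf.sub_le_sub (abs_nonneg y) hy hfu).trans (hbd x₀ le_rfl))
    · exact h1.trans (hbd _ hy)
  rw [← ENNReal.ofReal_toReal hqtop]
  refine ENNReal.ofReal_le_ofReal ?_
  have h2 : q.toReal / 2 ≤ Real.exp (-youngFenchel φ u) := by
    rw [← Real.log_le_iff_le_exp (by positivity)]
    linarith
  linarith

lemma IsSpanProcess.measurable_eLpNorm [SFinite P] {G : ℝ → Ω → ℝ}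
    (hG : IsSpanProcess P X T G) : Measurable fun t => eLpNorm (G t) 2 P := by
  simp_rw [← secondMoment_rpow_half]
  refine Measurable.pow_const ?_ _
  have : Measurable fun q : ℝ × Ω => ENNReal.ofReal (G q.1 q.2 ^ 2) :=
    (hG.meas.pow_const 2).ennreal_ofReal
  exact this.lintegral_prod_right'

/-- If the mean square norms vanish on average, then so do the paths. -/
lemma IsSpanProcess.measure_eq_zero [SFinite P] {G : ℝ → Ω → ℝ} (hG : IsSpanProcess P X T G)
    {p ε : ℝ} (hp : 0 < p)
    (h : ∫⁻ t in Set.Icc 0 T, secondMoment P (G t) ^ (p / 2) = 0) :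
    P {ω | ENNReal.ofReal ε < ∫⁻ t in Set.Icc 0 T, ENNReal.ofReal (|G t ω| ^ p)} = 0 := by
  simp_rw [secondMoment_rpow_div_two] at h
  rw [lintegral_eq_zero_iff (hG.measurable_eLpNorm.pow_const p)] at h
  have hm : MeasurableSet {q : ℝ × Ω | G q.1 q.2 = 0} := hG.meas (measurableSet_singleton 0)
  have hae : ∀ᵐ ω ∂P, ∀ᵐ t ∂volume.restrict (Set.Icc 0 T), G t ω = 0 := by
    refine (Measure.ae_ae_comm (p := fun t ω => G t ω = 0) hm).1 ?_
    filter_upwards [h] with t ht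
    have h0 : eLpNorm (G t) 2 P = 0 := (ENNReal.rpow_eq_zero_iff_of_pos hp).1 ht
    exact (eLpNorm_eq_zero_iff (hG.mem t).aemeasurable.aestronglyMeasurable (by norm_num)).1 h0
  refine measure_eq_zero_iff_ae_notMem.2 ?_
  filter_upwards [hae] with ω hω
  have : ∫⁻ t in Set.Icc 0 T, ENNReal.ofReal (|G t ω| ^ p) = 0 := by
    refine (lintegral_congr_ae (hω.mono fun t ht => ?_)).trans lintegral_zero
    simp [ht, Real.zero_rpow hp.ne']
  simp [this]

/-- The tail bound for processes in the closed linear span of a strictly sub-Gaussian process. -/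
lemma IsSpanProcess.measure_le [IsProbabilityMeasure P] (hφ : IsOrliczN φ)
    (hX : IsStrictlySubFamily φ P (Set.range X) C) {G : ℝ → Ω → ℝ}
    (hG : IsSpanProcess P X T G) {p ε : ℝ} (hp : 0 < p) (hε : 0 < ε) {cn : ℝ≥0∞}
    (hcn : cn = ENNReal.ofReal C ^ p * ∫⁻ t in Set.Icc 0 T, secondMoment P (G t) ^ (p / 2))
    (hcn0 : 0 < cn) {f : ℝ → ℝ} (hf : IsDensity φ f)
    (hfε : cn.toReal * f (p * (cn.toReal / ε) ^ (1 / p)) ^ p < ε) :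
    P {ω | ENNReal.ofReal ε < ∫⁻ t in Set.Icc 0 T, ENNReal.ofReal (|G t ω| ^ p)}
      ≤ ENNReal.ofReal (2 * Real.exp (-youngFenchel φ ((ε / cn.toReal) ^ (1 / p)))) := by
  have hC := hX.1
  have hcntop : cn ≠ ∞ := by
    rw [hcn]
    exact ENNReal.mul_ne_top (ENNReal.rpow_ne_top_of_nonneg hp.le ENNReal.ofReal_ne_top)
      (hG.lintegral_lt_top hp.le).ne
  have hc : 0 < cn.toReal := ENNReal.toReal_pos hcn0.ne' hcntop
  set c := cn.toReal with hcdef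
  set u : ℝ := (ε / c) ^ (1 / p) with hu
  have hu0 : 0 < u := by positivity
  have hup : u ^ p = ε / c := by
    rw [hu, ← Real.rpow_mul (by positivity), one_div_mul_cancel hp.ne', Real.rpow_one]
  have hinv : p * (c / ε) ^ (1 / p) = p / u := by
    rw [← inv_div ε c, Real.inv_rpow (by positivity), ← hu, div_eq_mul_inv]
  rw [hinv] at hfε
  have hpu : 0 ≤ p / u := by positivity
  have hf0 : 0 ≤ f (p / u) := by
    rw [← hf.map_zero]
    exact hf.mono Set.self_mem_Ici hpu hpu
  -- Dividing by `c`, the condition on `ε` reads `f (p / u) ^ p < u ^ p`.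
  have hfu : f (p / u) ≤ u := by
    refine ((Real.rpow_lt_rpow_iff hf0 hu0.le hp).1 ?_).le
    rw [hup, lt_div_iff₀ hc, mul_comm]
    exact hfε
  have hfin : ∀ t, eLpNorm (G t) 2 P ≠ ∞ := fun t => by
    obtain ⟨g, -, hg⟩ := hG.mem t
    rw [eLpNorm_congr_ae hg]
    exact Lp.eLpNorm_ne_top g
  refine le_two_mul_exp_neg_youngFenchel hφ hf hu0.le hfu fun x hx => ?_
  refine measure_lt_lintegral_le hφ (b := fun t => C * (eLpNorm (G t) 2 P).toReal) hG.meas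
    (hG.measurable_eLpNorm.ennreal_toReal.const_mul C) (fun t => by positivity)
    (Eventually.of_forall fun t => (hG.mem t).expBound hφ hX) (Eventually.of_forall fun t ht => ?_)
    hp hc ?_ hε ?_
  · have h1 : (eLpNorm (G t) 2 P).toReal = 0 := (mul_eq_zero.1 ht).resolve_left hC.ne'
    have h0 : eLpNorm (G t) 2 P = 0 :=
      ((ENNReal.toReal_eq_zero_iff _).1 h1).resolve_right (hfin t)
    exact (eLpNorm_eq_zero_iff (hG.mem t).aemeasurable.aestronglyMeasurable (by norm_num)).1 h0
  · rw [hcdef, ENNReal.ofReal_toReal hcntop, hcn, ← lintegral_const_mul' _ _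
      (ENNReal.rpow_ne_top_of_nonneg hp.le ENNReal.ofReal_ne_top)]
    refine lintegral_congr fun t => ?_
    rw [secondMoment_rpow_div_two, ← ENNReal.mul_rpow_of_nonneg _ _ hp.le,
      ← ENNReal.ofReal_rpow_of_nonneg (by positivity) hp.le, ENNReal.ofReal_mul hC.le,
      ENNReal.ofReal_toReal (hfin t)]
  · rwa [div_le_iff₀ hu0, mul_comm] at hx

end TailBound

end PhiSub

/-! ### The theorem. -/

theorem mainTheorem5 {Ω : Type*} [MeasurableSpace Ω] (P : Measure Ω) [IsProbabilityMeasure P]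
    (φ : ℝ → ℝ) (hφ : PhiSub.IsOrliczN φ) (hQ : PhiSub.AssumptionQ φ)
    (X : ℝ → Ω → ℝ) (hXmeas : Measurable (Function.uncurry X))
    (C : ℝ) (hX : PhiSub.IsStrictlySubFamily φ P (Set.range X) C)
    (T p : ℝ) (hT : 0 < T) (hp : 1 ≤ p) :
    -- the integrability of `τ_φ(X(t)) ^ p`
    ((∫⁻ t in Set.Icc 0 T, PhiSub.secondMoment P (X t) ^ (p / 2) < ∞) →
      ∫⁻ t in Set.Icc 0 T, PhiSub.tau φ P (X t) ^ p < ∞) ∧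
    -- the wavelet approximations, under the standing assumptions on wavelets and process
    ∀ w v Φ c A : ℝ → ℝ, PhiSub.IsFWavelet w → PhiSub.IsMWavelet w v →
      Continuous w → Continuous v → PhiSub.AssumptionS w Φ → PhiSub.AssumptionS v Φ →
      PhiSub.IsWeight c A → Integrable (fun x : ℝ => c x * Φ |x|) →
      PhiSub.IsTauContinuous φ P X → (∀ t, PhiSub.tau φ P (X t) ≤ ENNReal.ofReal (c t)) →
      -- the Cauchy condition
      (∀ (k' : ℕ → ℕ) (kk : ℕ → ℕ → ℕ), Tendsto k' atTop atTop →
        (∀ j, Tendsto (fun n => kk n j) atTop atTop) →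
        Tendsto (fun nm : ℕ × ℕ => ∫⁻ t in Set.Icc 0 T,
            PhiSub.secondMoment P (fun ω =>
              PhiSub.approx P w v X nm.1 (k' nm.1) (kk nm.1) t ω
                - PhiSub.approx P w v X nm.2 (k' nm.2) (kk nm.2) t ω) ^ (p / 2))
          (atTop ×ˢ atTop) (𝓝 0) →
        Tendsto (fun nm : ℕ × ℕ => ∫⁻ t in Set.Icc 0 T,
            PhiSub.tau φ P (fun ω =>
              PhiSub.approx P w v X nm.1 (k' nm.1) (kk nm.1) t ω
                - PhiSub.approx P w v X nm.2 (k' nm.2) (kk nm.2) t ω) ^ p)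
          (atTop ×ˢ atTop) (𝓝 0)) ∧
      -- the tail bound
      (∀ (n k' : ℕ) (kk : ℕ → ℕ) (cn : ℝ≥0∞),
        cn = ENNReal.ofReal C ^ p * ∫⁻ t in Set.Icc 0 T,
          PhiSub.secondMoment P (fun ω => PhiSub.approx P w v X n k' kk t ω - X t ω) ^ (p / 2) →
        cn < ∞ ∧ ∀ ε : ℝ, 0 < ε →
          (cn = 0 → P {ω | ENNReal.ofReal ε < ∫⁻ t in Set.Icc 0 T,
            ENNReal.ofReal (|PhiSub.approx P w v X n k' kk t ω - X t ω| ^ p)} = 0) ∧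
          (0 < cn → ∀ f : ℝ → ℝ, PhiSub.IsDensity φ f →
            cn.toReal * f (p * (cn.toReal / ε) ^ (1 / p)) ^ p < ε →
            P {ω | ENNReal.ofReal ε < ∫⁻ t in Set.Icc 0 T,
              ENNReal.ofReal (|PhiSub.approx P w v X n k' kk t ω - X t ω| ^ p)}
              ≤ ENNReal.ofReal
                (2 * Real.exp (-PhiSub.youngFenchel φ ((ε / cn.toReal) ^ (1 / p)))))) := by
  have hp0 : 0 ≤ p := by linarith
  have hp1 : 0 < p := by linarith
  have hCp : ENNReal.ofReal C ^ p ≠ ∞ :=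
    ENNReal.rpow_ne_top_of_nonneg hp0 ENNReal.ofReal_ne_top
  refine ⟨fun h => (PhiSub.lintegral_tau_rpow_le hφ hX hp0
    (PhiSub.inClosedSpan_self hφ hX)).trans_lt (ENNReal.mul_lt_top hCp.lt_top h), ?_⟩
  intro w v Φ c A _ _ hw hv _ _ hc _ _ hXc
  refine ⟨fun k' kk _ _ hlim => ?_, fun n k' kk cn hcn => ?_⟩
  · have h0 := ENNReal.Tendsto.const_mul hlim (Or.inr hCp)
    rw [mul_zero] at h0
    exact tendsto_of_tendsto_of_tendsto_of_le_of_le tendsto_const_nhds h0 (fun _ => zero_le)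
      fun nm => PhiSub.lintegral_tau_rpow_le hφ hX hp0
        ((PhiSub.isSpanProcess_approx (T := T) hw hv nm.1 (k' nm.1) (kk nm.1)).sub
          (PhiSub.isSpanProcess_approx hw hv nm.2 (k' nm.2) (kk nm.2))).mem
  · have hG := (PhiSub.isSpanProcess_approx (P := P) (X := X) (T := T) hw hv n k' kk).sub
      (PhiSub.isSpanProcess_self hφ hX hXmeas hc hXc)
    refine ⟨hcn ▸ ENNReal.mul_lt_top hCp.lt_top (hG.lintegral_lt_top hp0), fun ε hε =>
      ⟨fun h0 => hG.measure_eq_zero hp1 ?_, fun hpos f hf hfε =>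
        hG.measure_le hφ hX hp1 hε hcn hpos hf hfε⟩⟩
    -- As `C > 0`, a vanishing `cn` forces the integral of the mean square norms to vanish.
    refine (mul_eq_zero.1 (hcn.symm.trans h0)).resolve_left ?_
    exact (ENNReal.rpow_pos (ENNReal.ofReal_pos.2 hX.1) ENNReal.ofReal_ne_top).ne'
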